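/- Let $W=(W_t)_{t\ge 0}$ be a standard real-valued Brownian motion on a probability space $(\Omega,\mathcal A,\mathbb P)$, and let $\mu(\delta):=\sqrt{2\delta\ln(1/\delta)}$ for $0<\delta<1$. Then $$\limsup_{\delta\searrow 0}\ \max_{\substack{0\le s<t\le 1\\ t-s\le\delta}}\frac{|W_s-W_t|}{\mu(\delta)}=1\qquad \mathbb P\text{-almost surely.}$$ Moreover, writing $\mathbb N=\{1,2,\dots\}$ and $\#$ for the (possibly infinite) number of elements of a set: (1) For all $\theta\in(0,1)$, $0<\eta<\theta$ and $0\le p<\frac{1}{e^{\eta}\sqrt{4\pi(1-\theta)}}$ there is a constant $K_1>0$, depending only on $\theta,\eta,p$, such that for all integers $k\ge 1$ $$\mathbb P\Big(\#\Big\{n\in\mathbb N:\ \frac{\max_{1\le j\le\lceil e^n\rceil}|W_{j/e^n}-W_{(j-1)/e^n}|}{\mu(e^{-n})}\le\sqrt{1-\theta}\Big\}\ge k\Big)\le K_1\exp\big(-p\exp(\eta k)\big).$$ (2) For all $\theta\in(0,1)$ and $\varepsilon>\frac{1+\theta}{1-\theta}-1$, with $\rho:=(1-\theta)(1+\varepsilon)^2-(1+\theta)$,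 there is a constant $K>0$, depending only on $\varepsilon,\theta$, such that for all integers $k\ge 1$ $$\mathbb P\Big(\#\Big\{n\in\mathbb N,\ n\ge\tfrac1{1-\theta}:\ \max_{\substack{0\le i<j\le\lceil e^n\rceil\\ 1\le j-i\le\lceil e^{n\theta}\rceil}}\frac{|W_{j/e^n}-W_{i/e^n}|}{\mu((j-i)e^{-n})}\ge 1+\varepsilon\Big\}\ge k\Big)\le 2e^{9/8}\Big[k\Big(\frac{K}{1-e^{-\rho}}\,e^{-\rho(\lceil\frac1{1-\theta}\rceil-1)}+1\Big)+1\Big]e^{-\rho k}.$$ -/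

import Mathlib

open MeasureTheory ProbabilityTheory Filter Topology
open scoped NNReal

universe u

namespace LevyModulus

/-- Lévy's modulus `μ(δ) = √(2 δ ln(1/δ))`. -/
noncomputable def mu (δ : ℝ) : ℝ := Real.sqrt (2 * δ * Real.log (1 / δ))

/-- For a path `w`, the maximum of `|w s - w t| / μ(δ)` over `0 ≤ s < t ≤ 1` with `t - s ≤ δ`.
It is taken as a supremum in `[-∞, ∞]`, so it is meaningful for every path; for a continuous
path and `0 < δ < 1` it is attained. -/
noncomputable def maxRatio (w : ℝ≥0 → ℝ) (δ : ℝ) : EReal :=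
  ⨆ (s : ℝ≥0) (t : ℝ≥0) (_ : s < t) (_ : t ≤ 1) (_ : (t : ℝ) - (s : ℝ) ≤ δ),
    ((|w s - w t| / mu δ : ℝ) : EReal)

/-- The grid point `j / e ^ n`. -/
noncomputable def gridPt (n j : ℕ) : ℝ≥0 := Real.toNNReal ((j : ℝ) / Real.exp n)

lemma one_le_ceil_exp (x : ℝ) : 1 ≤ ⌈Real.exp x⌉₊ :=
  Nat.one_le_ceil_iff.mpr (Real.exp_pos x)

/-- The maximum of `|w (j / e^n) - w ((j-1) / e^n)| / μ(e^{-n})` over `1 ≤ j ≤ ⌈e^n⌉`. -/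
noncomputable def maxGridIncr (w : ℝ≥0 → ℝ) (n : ℕ) : ℝ :=
  (Finset.Icc 1 ⌈Real.exp n⌉₊).sup' (Finset.nonempty_Icc.mpr (one_le_ceil_exp n))
      (fun j => |w (gridPt n j) - w (gridPt n (j - 1))|) / mu (Real.exp (-(n : ℝ)))

/-- The pairs `(i, j)` with `0 ≤ i < j ≤ ⌈e^n⌉` and `1 ≤ j - i ≤ ⌈e^{nθ}⌉`. -/
noncomputable def gridPairs (θ : ℝ) (n : ℕ) : Finset (ℕ × ℕ) :=
  ((Finset.range (⌈Real.exp n⌉₊ + 1)) ×ˢ (Finset.range (⌈Real.exp n⌉₊ + 1))).filter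
    (fun q => q.1 < q.2 ∧ q.2 - q.1 ≤ ⌈Real.exp ((n : ℝ) * θ)⌉₊)

lemma gridPairs_nonempty (θ : ℝ) (n : ℕ) : (gridPairs θ n).Nonempty := by
  refine ⟨(0, 1), ?_⟩
  have h1 := one_le_ceil_exp (n : ℝ)
  have h2 := one_le_ceil_exp ((n : ℝ) * θ)
  simp only [gridPairs, Finset.mem_filter, Finset.mem_product, Finset.mem_range]
  omega

/-- The maximum of `|w (j / e^n) - w (i / e^n)| / μ((j - i) e^{-n})` over `gridPairs θ n`. -/
noncomputable def maxGridRatio (w : ℝ≥0 → ℝ) (θ : ℝ) (n : ℕ) : ℝ :=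
  (gridPairs θ n).sup' (gridPairs_nonempty θ n)
    (fun q => |w (gridPt n q.2) - w (gridPt n q.1)| /
      mu (((q.2 : ℝ) - (q.1 : ℝ)) * Real.exp (-(n : ℝ))))

/-- The number (possibly infinite) of `n ≥ 1` at which the largest normalised increment
over neighbouring grid points is at most `√(1 - θ)`. -/
noncomputable def lowerCount (w : ℝ≥0 → ℝ) (θ : ℝ) : ℕ∞ :=
  {n : ℕ | 1 ≤ n ∧ maxGridIncr w n ≤ Real.sqrt (1 - θ)}.encard

/-- The number (possibly infinite) of `n ≥ 1 / (1 - θ)` at which the largest normalised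
increment over pairs of close grid points is at least `1 + ε`. -/
noncomputable def upperCount (w : ℝ≥0 → ℝ) (θ ε : ℝ) : ℕ∞ :=
  {n : ℕ | 1 ≤ n ∧ 1 / (1 - θ) ≤ (n : ℝ) ∧ 1 + ε ≤ maxGridRatio w θ n}.encard

end LevyModulus

/-!
Both counting estimates come from a union bound. If `k` of the levels `n = 1, 2, …` are exceptional,
one of them is at least `k`, so the probability is at most the tail `∑_{n ≥ k}` of the
probabilities of the single levels.

* For the lower count, the `⌈e ^ n⌉ - 1` first grid increments are independent centred Gaussians of
  variance `e ^ {-n}`, and each of them exceeds `√(1 - θ) μ(e ^ {-n})` with probability at least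
  `exp (-(1 - θ) n - O(√n))`. All of them stay below with probability at most
  `exp (-exp (θ n - O(√n)))`, and for `η < θ` this is at most a constant times
  `exp (-p exp (η n)) e ^ {-n}` (`exists_measureReal_smallIncrEvent_le`).
* For the upper count, an increment over an interval of length `d` exceeds `(1 + ε) μ(d)` with
  probability at most `2 d ^ ((1 + ε) ^ 2)`. There are `O(e ^ {n (1 + θ)})` pairs, all with
  `d = O(e ^ {-n (1 - θ)})`, which gives `O(e ^ {-ρ n})` (`measureReal_largeRatioEvent_le`).

Since the probabilities of the single levels are summable, the Borel–Cantelli lemma makes almost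
every path regular at all fine levels. For the limsup, the lower count directly exhibits close
pairs with ratio above `√(1 - θ)` at the scales `δ = e ^ {-n}`, for every `θ > 0`. For the upper
bound, given `δ` take the largest `n` with `δ ≤ e ^ {-n (1 - θ)}`, and round `s` and `t` to the grid
of mesh `e ^ {-n}`. The grid pair is controlled by the upper count. The rounding errors are
`O(e ^ {-β n}) = O(δ ^ (β / (1 - θ)))` as soon as the path is `β`-Hölder, which is
negligible against `√δ` if `(1 - θ) / 2 < β`; such a `β < 1 / 2` exists because `θ > 0`. The Hölder
bound (`ae_exists_abs_sub_le_rpow`) is obtained by dyadic chaining.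
-/

namespace LevyModulus

variable {Ω : Type*} {mΩ : MeasurableSpace Ω} {P : Measure Ω} {W : ℝ≥0 → Ω → ℝ}

/-! ### Union bounds and Gaussian tails -/

lemma exists_ge_of_le_encard {S : Set ℕ} (hS : ∀ n ∈ S, 1 ≤ n) {k : ℕ} (hk : 1 ≤ k)
    (h : (k : ℕ∞) ≤ S.encard) : ∃ n ≥ k, n ∈ S := by
  by_contra! hcon
  have hsub : S ⊆ (Finset.Icc 1 (k - 1) : Finset ℕ) := fun n hn ↦ by
    have h1 := hS n hn
    have h2 : n < k := by
      by_contra! h3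
      exact hcon n h3 hn
    simp only [Finset.coe_Icc, Set.mem_Icc]
    omega
  have h3 := h.trans (Set.encard_le_encard hsub)
  rw [Set.encard_coe_eq_coe_finsetCard, Nat.card_Icc] at h3
  have : k ≤ k - 1 + 1 - 1 := by exact_mod_cast h3
  omega

/-- Union bound for a geometrically decaying sequence of events. -/
lemma measureReal_exists_ge_le [IsFiniteMeasure P] {A : ℕ → Set Ω} {c r : ℝ} {k : ℕ}
    (hr0 : 0 ≤ r) (hr1 : r < 1) (hA : ∀ n ≥ k, P.real (A n) ≤ c * r ^ n) :
    P.real {ω | ∃ n ≥ k, ω ∈ A n} ≤ c / (1 - r) * r ^ k := by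
  have hsum : HasSum (fun n : ℕ ↦ c * r ^ (n + k)) (c / (1 - r) * r ^ k) := by
    have := ((hasSum_geometric_of_lt_one hr0 hr1).mul_left (c * r ^ k))
    rw [show c / (1 - r) * r ^ k = c * r ^ k * (1 - r)⁻¹ by ring]
    simpa only [pow_add, mul_assoc, mul_comm (r ^ k)] using! this
  have hnn : ∀ n, 0 ≤ c * r ^ (n + k) := fun n ↦
    measureReal_nonneg.trans (hA (n + k) (by omega))
  have hsub : {ω | ∃ n ≥ k, ω ∈ A n} ⊆ ⋃ n, A (n + k) := by
    rintro ω ⟨n, hn, hω⟩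
    exact Set.mem_iUnion.2 ⟨n - k, by rwa [Nat.sub_add_cancel hn]⟩
  rw [measureReal_def]
  refine ENNReal.toReal_le_of_le_ofReal (hsum.nonneg hnn) ?_
  calc P {ω | ∃ n ≥ k, ω ∈ A n} ≤ P (⋃ n, A (n + k)) := measure_mono hsub
    _ ≤ ∑' n, P (A (n + k)) := measure_iUnion_le _
    _ ≤ ∑' n, ENNReal.ofReal (c * r ^ (n + k)) := by
        refine ENNReal.tsum_le_tsum fun n ↦ ?_
        rw [← ENNReal.ofReal_toReal (measure_ne_top P (A (n + k)))]
        exact ENNReal.ofReal_le_ofReal (hA (n + k) (by omega))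
    _ = ENNReal.ofReal (c / (1 - r) * r ^ k) := by
        rw [← ENNReal.ofReal_tsum_of_nonneg hnn hsum.summable, hsum.tsum_eq]

/-- The first Borel–Cantelli lemma for events whose probabilities are dominated by a summable
real sequence. -/
lemma ae_eventually_notMem_of_summable [IsFiniteMeasure P] {A : ℕ → Set Ω} {a : ℕ → ℝ}
    (ha : Summable a) (hA : ∀ n, P.real (A n) ≤ a n) : ∀ᵐ ω ∂P, ∀ᶠ n in atTop, ω ∉ A n := by
  refine ae_eventually_notMem (ne_top_of_le_ne_top ha.tsum_ofReal_ne_top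
    (ENNReal.tsum_le_tsum fun n ↦ ?_))
  rw [← ENNReal.ofReal_toReal (measure_ne_top P (A n))]
  exact ENNReal.ofReal_le_ofReal (hA n)

lemma measureReal_le_abs_of_hasLaw_gaussianReal {X : Ω → ℝ} {v : ℝ≥0}
    (hX : HasLaw X (gaussianReal 0 v) P) {x : ℝ} (hx : 0 ≤ x) :
    P.real {ω | x ≤ |X ω|} ≤ 2 * Real.exp (-x ^ 2 / (2 * v)) := by
  have hprob : IsProbabilityMeasure P := hX.isProbabilityMeasure
  have key : ∀ Y : Ω → ℝ, HasLaw Y (gaussianReal 0 v) P →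
      P.real {ω | x ≤ Y ω} ≤ Real.exp (-x ^ 2 / (2 * v)) := by
    intro Y hY
    have hsub : HasSubgaussianMGF Y v P :=
      { integrable_exp_mul := fun t ↦ by
          have := integrable_exp_mul_gaussianReal (μ := 0) (v := v) t
          rw [← hY.map_eq] at this
          exact this.comp_aemeasurable hY.aemeasurable
        mgf_le := fun t ↦ by
          rw [mgf_gaussianReal hY.map_eq]
          simp }
    exact hsub.measure_ge_le hx
  have hneg : HasLaw (-X) (gaussianReal 0 v) P := by simpa using gaussianReal_neg hX
  calc P.real {ω | x ≤ |X ω|} ≤ P.real ({ω | x ≤ X ω} ∪ {ω | x ≤ (-X) ω}) := by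
        refine measureReal_mono fun ω hω ↦ ?_
        exact le_abs.1 (show x ≤ |X ω| from hω)
    _ ≤ _ := measureReal_union_le _ _
    _ ≤ _ := by linarith [key X hX, key (-X) hneg]

/-- A crude lower bound on the Gaussian tail beyond `x` standard deviations, from the mass of
`(x, x + 1]` alone. It loses a factor `exp (-O(x))` against the true tail, which is harmless here. -/
lemma measureReal_abs_le_of_hasLaw_gaussianReal {X : Ω → ℝ} {v : ℝ≥0} (hv : v ≠ 0)
    (hX : HasLaw X (gaussianReal 0 v) P) {x : ℝ} (hx : 0 ≤ x) :
    P.real {ω | |X ω| ≤ x * √v} ≤ Real.exp (-(1 / 4 * Real.exp (-(x + 1) ^ 2 / 2))) := by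
  have hv' : (0 : ℝ) < v := by exact_mod_cast pos_of_ne_zero hv
  have hs : 0 < √(v : ℝ) := Real.sqrt_pos.2 hv'
  have hss : √(v : ℝ) ^ 2 = v := Real.sq_sqrt hv'.le
  set I := Set.Ioc (x * √v) ((x + 1) * √v) with hI
  have hlow : 1 / 4 * Real.exp (-(x + 1) ^ 2 / 2) ≤ (gaussianReal 0 v).real I := by
    rw [measureReal_def, gaussianReal_apply_eq_integral _ hv, ENNReal.toReal_ofReal
      (setIntegral_nonneg measurableSet_Ioc fun y _ ↦ gaussianPDFReal_nonneg 0 v y)]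
    have hvol : (volume : Measure ℝ).real I = √v := by
      rw [measureReal_def, Real.volume_Ioc, ENNReal.toReal_ofReal (by nlinarith)]
      ring
    have h1 : ∀ y ∈ I, (√(2 * Real.pi * v))⁻¹ * Real.exp (-(x + 1) ^ 2 / 2)
        ≤ gaussianPDFReal 0 v y := by
      intro y hy
      rw [gaussianPDFReal]
      refine mul_le_mul_of_nonneg_left (Real.exp_le_exp.2 ?_) (by positivity)
      rw [sub_zero, neg_div, neg_div, neg_le_neg_iff, div_le_div_iff₀ (by positivity) two_pos]
      have hy0 : 0 ≤ y := (mul_nonneg hx hs.le).trans hy.1.le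
      have : y ^ 2 ≤ ((x + 1) * √v) ^ 2 := pow_le_pow_left₀ hy0 hy.2 2
      rw [mul_pow, hss] at this
      linarith
    have h2 := setIntegral_ge_of_const_le_real (μ := volume) measurableSet_Ioc (by simp) h1
      (integrable_gaussianPDFReal 0 v).integrableOn
    refine le_trans ?_ h2
    rw [hvol, Real.sqrt_mul (by positivity)]
    have hpi : √(2 * Real.pi) ≤ 4 := by
      rw [Real.sqrt_le_left (by norm_num)]
      nlinarith [Real.pi_le_four]
    have : (√(2 * Real.pi) * √v)⁻¹ * Real.exp (-(x + 1) ^ 2 / 2) * √v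
        = 1 / √(2 * Real.pi) * Real.exp (-(x + 1) ^ 2 / 2) := by
      field_simp
    rw [this]
    gcongr
  calc P.real {ω | |X ω| ≤ x * √v} = P.real (X ⁻¹' {y | |y| ≤ x * √v}) := rfl
    _ = (gaussianReal 0 v).real {y | |y| ≤ x * √v} := by
        rw [← hX.map_eq, map_measureReal_apply_of_aemeasurable hX.aemeasurable]
        exact measurableSet_le (by fun_prop) measurable_const
    _ ≤ (gaussianReal 0 v).real Iᶜ := by
        refine measureReal_mono fun y hy hyI ↦ ?_
        exact absurd ((le_abs_self y).trans hy) (not_le.2 hyI.1)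
    _ = 1 - (gaussianReal 0 v).real I := probReal_compl_eq_one_sub measurableSet_Ioc
    _ ≤ 1 - 1 / 4 * Real.exp (-(x + 1) ^ 2 / 2) := by linarith
    _ ≤ _ := Real.one_sub_le_exp_neg _

/-- By independence of the increments, it is doubly exponentially unlikely in the threshold that all
of `N` consecutive increments of step `h` stay small. -/
lemma measureReal_forall_increment_le (hW : IsPreBrownianReal W P) {h : ℝ≥0} (hh : h ≠ 0)
    (N : ℕ) {x : ℝ} (hx : 0 ≤ x) :
    P.real {ω | ∀ j < N, |W ((j + 1 : ℕ) * h) ω - W (j * h) ω| ≤ x * √h}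
      ≤ Real.exp (-(N / 4 * Real.exp (-(x + 1) ^ 2 / 2))) := by
  have hmono : Monotone fun j : ℕ ↦ (j : ℝ≥0) * h := fun a b hab ↦ by
    dsimp only; gcongr
  have hind := hW.hasIndepIncrements.nat hmono
  have hm : MeasurableSet {y : ℝ | |y| ≤ x * √h} :=
    measurableSet_le (by fun_prop) measurable_const
  have hset : {ω | ∀ j < N, |W ((j + 1 : ℕ) * h) ω - W (j * h) ω| ≤ x * √h}
      = ⋂ j ∈ Finset.range N, (fun ω ↦ W ((j + 1 : ℕ) * h) ω - W (j * h) ω) ⁻¹'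
          {y : ℝ | |y| ≤ x * √h} := by
    ext ω; simp
  rw [hset, measureReal_def, hind.measure_inter_preimage_eq_mul _ fun _ _ ↦ hm,
    ENNReal.toReal_prod]
  calc _ ≤ ∏ _j ∈ Finset.range N, Real.exp (-(1 / 4 * Real.exp (-(x + 1) ^ 2 / 2))) := by
        refine Finset.prod_le_prod (fun _ _ ↦ ENNReal.toReal_nonneg) fun j _ ↦ ?_
        have hlaw := hW.hasLaw_sub ((j + 1 : ℕ) * h) (j * h)
        have hd : nndist (((j + 1 : ℕ) * h : ℝ≥0) : ℝ) ((j * h : ℝ≥0) : ℝ) = h := by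
          rw [← NNReal.coe_inj, coe_nndist, Real.dist_eq]
          push_cast
          rw [show ((j : ℝ) + 1) * h - j * h = h by ring, abs_of_nonneg (NNReal.coe_nonneg h)]
        rw [show (((j + 1 : ℕ) * h : ℝ≥0)).1 = (((j + 1 : ℕ) * h : ℝ≥0) : ℝ) from rfl,
          show ((j * h : ℝ≥0)).1 = ((j * h : ℝ≥0) : ℝ) from rfl, hd] at hlaw
        exact measureReal_abs_le_of_hasLaw_gaussianReal hh hlaw hx
    _ = _ := by
        rw [Finset.prod_const, Finset.card_range, ← Real.exp_nat_mul]
        ring_nf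

/-- The modulus `mu` is scaled so that the Gaussian tail of an increment becomes a power of the
distance `t - s`. -/
lemma measureReal_le_abs_sub_div_mu (hW : IsPreBrownianReal W P) {s t : ℝ≥0} (hst : s < t)
    {ε : ℝ} (hε : 0 ≤ ε) :
    P.real {ω | 1 + ε ≤ |W t ω - W s ω| / mu (t - s)} ≤ 2 * ((t : ℝ) - s) ^ ((1 + ε) ^ 2) := by
  have hprob : IsProbabilityMeasure P := hW.isGaussianProcess.isProbabilityMeasure
  have hd : 0 < (t : ℝ) - s := sub_pos.2 (by exact_mod_cast hst)
  set d := (t : ℝ) - s with hdef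
  have hpos : 0 ≤ 2 * d ^ ((1 + ε) ^ 2) := by positivity
  rcases (show 0 ≤ mu d from Real.sqrt_nonneg _).eq_or_lt with h0 | h0
  -- If `d ≥ 1` then `mu d = 0`, the quotient is the junk value `0` and the event is empty.
  · have : {ω | 1 + ε ≤ |W t ω - W s ω| / mu d} = ∅ := by
      ext ω
      simp only [← h0, div_zero, Set.mem_ofPred_eq, Set.mem_empty_iff_false, iff_false, not_le]
      linarith
    simpa [this] using hpos
  · have hlaw := hW.hasLaw_sub t s
    have hn : ((nndist t.1 s.1 : ℝ≥0) : ℝ) = d := by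
      rw [coe_nndist, Real.dist_eq]
      exact abs_of_pos hd
    have hsq : mu d ^ 2 = 2 * d * Real.log (1 / d) := by
      refine Real.sq_sqrt ?_
      by_contra! hneg
      exact h0.ne' (Real.sqrt_eq_zero_of_nonpos hneg.le)
    have h1 := measureReal_le_abs_of_hasLaw_gaussianReal hlaw
      (x := (1 + ε) * mu d) (by positivity)
    have hset : {ω | 1 + ε ≤ |W t ω - W s ω| / mu d}
        = {ω | (1 + ε) * mu d ≤ |(W t - W s) ω|} := by
      ext ω
      simp only [Set.mem_ofPred_eq, le_div_iff₀ h0, Pi.sub_apply]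
    rw [hset]
    refine h1.trans_eq ?_
    rw [hn, mul_pow, hsq, Real.rpow_def_of_pos hd, one_div, Real.log_inv]
    congr 2
    field_simp

/-! ### Exceptional grid levels and the counting estimates -/

lemma coe_gridPt (n j : ℕ) : (gridPt n j : ℝ) = j / Real.exp n :=
  Real.coe_toNNReal _ (by positivity)

lemma gridPt_eq_mul (n j : ℕ) : gridPt n j = j * (Real.exp (-(n : ℝ))).toNNReal := by
  rw [← NNReal.coe_inj, coe_gridPt, NNReal.coe_mul, Real.coe_toNNReal _ (Real.exp_pos _).le,
    Real.exp_neg, NNReal.coe_natCast, div_eq_mul_inv]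

lemma gridPt_lt_gridPt {n i j : ℕ} (h : i < j) : gridPt n i < gridPt n j := by
  rw [← NNReal.coe_lt_coe, coe_gridPt, coe_gridPt]
  gcongr

lemma gridPt_sub_gridPt (n i j : ℕ) :
    (gridPt n j : ℝ) - gridPt n i = ((j : ℝ) - i) * Real.exp (-(n : ℝ)) := by
  rw [coe_gridPt, coe_gridPt, Real.exp_neg]
  ring

lemma mu_exp_neg (x : ℝ) : mu (Real.exp (-x)) = √(2 * Real.exp (-x) * x) := by
  rw [mu, one_div, Real.log_inv, Real.log_exp, neg_neg]

/-- The event that, at level `n`, all normalised increments over neighbouring grid points are at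
most `√(1 - θ)`. The last grid interval is left out because it may stick out of `[0, 1]`. -/
def smallIncrEvent (W : ℝ≥0 → Ω → ℝ) (θ : ℝ) (n : ℕ) : Set Ω :=
  {ω | ∀ j < ⌈Real.exp n⌉₊ - 1,
    |W (gridPt n (j + 1)) ω - W (gridPt n j) ω| ≤ √(1 - θ) * mu (Real.exp (-(n : ℝ)))}

lemma measureReal_smallIncrEvent_le (hW : IsPreBrownianReal W P) {θ : ℝ} (hθ : θ < 1) (n : ℕ) :
    P.real (smallIncrEvent W θ n)
      ≤ Real.exp (-((Real.exp n - 1) / 4 * Real.exp (-(√(2 * (1 - θ) * n) + 1) ^ 2 / 2))) := by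
  have hθ' : 0 ≤ 1 - θ := by linarith
  have hh : (Real.exp (-(n : ℝ))).toNNReal ≠ 0 := (Real.toNNReal_pos.2 (Real.exp_pos _)).ne'
  have h := measureReal_forall_increment_le hW hh (⌈Real.exp n⌉₊ - 1)
    (Real.sqrt_nonneg (2 * (1 - θ) * n))
  rw [Real.coe_toNNReal _ (Real.exp_pos _).le, ← Real.sqrt_mul (by positivity)] at h
  have hthr : √(1 - θ) * mu (Real.exp (-(n : ℝ))) = √(2 * (1 - θ) * n * Real.exp (-(n : ℝ))) := by
    rw [mu_exp_neg, ← Real.sqrt_mul hθ']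
    ring_nf
  simp only [smallIncrEvent, hthr, gridPt_eq_mul]
  refine h.trans (Real.exp_le_exp.2 (neg_le_neg ?_))
  have h1 : Real.exp n - 1 ≤ ((⌈Real.exp n⌉₊ - 1 : ℕ) : ℝ) := by
    rw [Nat.cast_sub (one_le_ceil_exp _), Nat.cast_one]
    linarith [Nat.le_ceil (Real.exp n)]
  gcongr

/-- The exponent `(e ^ n - 1) / 4 * exp (-(√(2(1-θ)n) + 1)² / 2)` is of order
`exp (θ n - O(√n))`, which for `η < θ` beats `p * exp (η n) + n`. -/
lemma exists_mul_exp_add_le {θ η : ℝ} (p : ℝ) (hθ : θ < 1) (hη : 0 < η) (hηθ : η < θ) :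
    ∃ C : ℝ, ∀ n : ℕ, p * Real.exp (η * n) + n
      ≤ C + (Real.exp n - 1) / 4 * Real.exp (-(√(2 * (1 - θ) * n) + 1) ^ 2 / 2) := by
  set κ := θ - η with hκ
  have hκ0 : 0 < κ := sub_pos.2 hηθ
  set a := Real.exp (-(1 / κ + 1 / 2)) / 8 with ha
  have ha0 : 0 < a := by positivity
  have htend : Tendsto (fun n : ℕ ↦ a * Real.exp (κ / 2 * n)) atTop atTop :=
    (Real.tendsto_exp_atTop.comp
      (tendsto_natCast_atTop_atTop.const_mul_atTop (by positivity))).const_mul_atTop ha0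
  have hev : ∀ᶠ n : ℕ in atTop, p * Real.exp (η * n) + n
      - (Real.exp n - 1) / 4 * Real.exp (-(√(2 * (1 - θ) * n) + 1) ^ 2 / 2) ≤ 0 := by
    filter_upwards [htend.eventually_ge_atTop (p + 1 / η), eventually_ge_atTop 1] with n hn h1
    have h1' : (1 : ℝ) ≤ n := by exact_mod_cast h1
    set x := √(2 * (1 - θ) * n) with hx
    have hx2 : x ^ 2 = 2 * (1 - θ) * n :=
      Real.sq_sqrt (mul_nonneg (by linarith) (by linarith))
    -- AM-GM: up to a constant, the square root costs half of the gain `κ * n` in the exponent.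
    have hxle : x ≤ κ / 2 * n + 1 / κ := by
      refine Real.sqrt_le_iff.2 ⟨by positivity, ?_⟩
      have : (κ / 2 * n + 1 / κ) ^ 2 = (κ / 2 * n - 1 / κ) ^ 2 + 2 * n := by
        field_simp
        ring
      nlinarith [sq_nonneg (κ / 2 * n - 1 / κ), mul_nonneg (hη.trans hηθ).le (zero_le_one.trans h1')]
    have hexp : Real.exp n / 2 ≤ Real.exp n - 1 := by
      linarith [Real.add_one_le_exp (n : ℝ)]
    have hmain : a * Real.exp (κ / 2 * n) * Real.exp (η * n)
        ≤ (Real.exp n - 1) / 4 * Real.exp (-(x + 1) ^ 2 / 2) := by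
      calc a * Real.exp (κ / 2 * n) * Real.exp (η * n)
          = Real.exp n / 2 / 4 *
              Real.exp (-(1 / κ + 1 / 2) + κ / 2 * n + η * n - n) := by
            rw [ha, Real.exp_sub, Real.exp_add, Real.exp_add]
            field_simp
            norm_num
        _ ≤ _ := by
            refine mul_le_mul (by linarith) (Real.exp_le_exp.2 ?_) (Real.exp_pos _).le
              (by linarith [Real.exp_pos n])
            rw [show -(x + 1) ^ 2 = -x ^ 2 - 2 * x - 1 by ring, hx2]
            have : κ * n = θ * n - η * n := by rw [hκ]; ring
            linarith
    have hnle : (n : ℝ) ≤ 1 / η * Real.exp (η * n) := by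
      rw [div_mul_eq_mul_div, one_mul, le_div_iff₀ hη]
      linarith [Real.add_one_le_exp (η * n)]
    have := mul_le_mul_of_nonneg_right hn (Real.exp_pos (η * n)).le
    linarith
  obtain ⟨C, hC⟩ := (isBoundedUnder_of_eventually_le hev).bddAbove_range
  exact ⟨C, fun n ↦ by linarith [hC (Set.mem_range_self n)]⟩

lemma exists_measureReal_smallIncrEvent_le {θ η : ℝ} (p : ℝ) (hθ : θ < 1) (hη : 0 < η)
    (hηθ : η < θ) :
    ∃ C : ℝ, 0 < C ∧ ∀ (Ω : Type u) (_ : MeasurableSpace Ω) (P : Measure Ω) (W : ℝ≥0 → Ω → ℝ),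
      IsPreBrownianReal W P → ∀ n : ℕ,
        P.real (smallIncrEvent W θ n)
          ≤ C * Real.exp (-p * Real.exp (η * n)) * Real.exp (-(n : ℝ)) := by
  obtain ⟨C, hC⟩ := exists_mul_exp_add_le p hθ hη hηθ
  refine ⟨Real.exp C, Real.exp_pos C, fun Ω _ P W hW n ↦ ?_⟩
  refine (measureReal_smallIncrEvent_le hW hθ n).trans ?_
  rw [← Real.exp_add, ← Real.exp_add, Real.exp_le_exp]
  linarith [hC n]

lemma mem_smallIncrEvent_of_maxGridIncr_le {θ : ℝ} {n : ℕ} (hn : 1 ≤ n) {ω : Ω}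
    (h : maxGridIncr (fun t ↦ W t ω) n ≤ √(1 - θ)) : ω ∈ smallIncrEvent W θ n := by
  intro j hj
  have hmu : 0 < mu (Real.exp (-(n : ℝ))) := by
    rw [mu_exp_neg]
    have : (0 : ℝ) < n := by exact_mod_cast hn
    positivity
  rw [maxGridIncr, div_le_iff₀ hmu] at h
  have := (Finset.sup'_le_iff _ _).1 h (j + 1) (Finset.mem_Icc.2 ⟨by omega, by omega⟩)
  simpa using this

/-- The event that, at level `n`, some normalised increment over a pair of close grid points is at
least `1 + ε`. -/
def largeRatioEvent (W : ℝ≥0 → Ω → ℝ) (θ ε : ℝ) (n : ℕ) : Set Ω :=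
  {ω | 1 + ε ≤ maxGridRatio (fun t ↦ W t ω) θ n}

lemma card_gridPairs_le (θ : ℝ) (n : ℕ) :
    (gridPairs θ n).card ≤ (⌈Real.exp n⌉₊ + 1) * ⌈Real.exp (n * θ)⌉₊ := by
  calc (gridPairs θ n).card
      ≤ (Finset.range (⌈Real.exp n⌉₊ + 1) ×ˢ Finset.range ⌈Real.exp (n * θ)⌉₊).card := by
        refine Finset.card_le_card_of_injOn (fun q ↦ (q.1, q.2 - q.1 - 1)) ?_ ?_
        · rintro ⟨i, j⟩ hq
          simp only [gridPairs, Finset.coe_filter, Finset.mem_product, Finset.mem_range,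
            Set.mem_ofPred_eq] at hq
          simp only [Finset.coe_product, Finset.coe_range, Set.mem_prod, Set.mem_Iio]
          omega
        · rintro ⟨i, j⟩ hq ⟨i', j'⟩ hq' heq
          simp only [gridPairs, Finset.coe_filter, Finset.mem_product, Finset.mem_range,
            Set.mem_ofPred_eq] at hq hq'
          simp only [Prod.mk.injEq] at heq ⊢
          omega
    _ = _ := by simp

lemma ceil_exp_le_two_mul {x : ℝ} (hx : 0 ≤ x) : (⌈Real.exp x⌉₊ : ℝ) ≤ 2 * Real.exp x := by
  have h1 := Nat.ceil_lt_add_one (Real.exp_pos x).le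
  have h2 := Real.one_le_exp hx
  linarith

lemma measureReal_largeRatioEvent_le (hW : IsPreBrownianReal W P) {θ ε : ℝ} (hθ : 0 ≤ θ)
    (hε : 0 ≤ ε) (n : ℕ) :
    P.real (largeRatioEvent W θ ε n)
      ≤ 12 * 2 ^ ((1 + ε) ^ 2) * Real.exp (-((1 - θ) * (1 + ε) ^ 2 - (1 + θ)) * n) := by
  have hprob : IsProbabilityMeasure P := hW.isGaussianProcess.isProbabilityMeasure
  have hnθ : 0 ≤ n * θ := by positivity
  set B := 2 * (2 * Real.exp (n * θ) * Real.exp (-(n : ℝ))) ^ ((1 + ε) ^ 2) with hB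
  have hsub : largeRatioEvent W θ ε n ⊆ ⋃ q ∈ gridPairs θ n,
      {ω | 1 + ε ≤ |W (gridPt n q.2) ω - W (gridPt n q.1) ω| /
        mu ((gridPt n q.2 : ℝ) - gridPt n q.1)} := by
    intro ω hω
    obtain ⟨q, hq, hle⟩ := (Finset.le_sup'_iff _).1
      (show 1 + ε ≤ maxGridRatio (fun t ↦ W t ω) θ n from hω)
    refine Set.mem_biUnion hq ?_
    simpa only [Set.mem_ofPred_eq, gridPt_sub_gridPt] using hle
  have hq : ∀ q ∈ gridPairs θ n, P.real {ω | 1 + ε ≤ |W (gridPt n q.2) ω - W (gridPt n q.1) ω| /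
        mu ((gridPt n q.2 : ℝ) - gridPt n q.1)} ≤ B := by
    rintro ⟨i, j⟩ hq
    simp only [gridPairs, Finset.mem_filter] at hq
    refine (measureReal_le_abs_sub_div_mu hW (gridPt_lt_gridPt hq.2.1) hε).trans ?_
    have h1 : ((j : ℝ) - i) ≤ 2 * Real.exp (n * θ) := by
      rw [← Nat.cast_sub hq.2.1.le]
      exact (Nat.cast_le.2 hq.2.2).trans (ceil_exp_le_two_mul hnθ)
    have h0 : (0 : ℝ) ≤ (j : ℝ) - i := sub_nonneg.2 (by exact_mod_cast hq.2.1.le)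
    simp only [gridPt_sub_gridPt, hB]
    gcongr
  have hcard : ((gridPairs θ n).card : ℝ) ≤ 3 * Real.exp n * (2 * Real.exp (n * θ)) := by
    refine (Nat.cast_le.2 (card_gridPairs_le θ n)).trans ?_
    push_cast
    have h1 := ceil_exp_le_two_mul (Nat.cast_nonneg n : (0 : ℝ) ≤ n)
    have h2 := Real.one_le_exp (Nat.cast_nonneg n : (0 : ℝ) ≤ n)
    have h3 := ceil_exp_le_two_mul hnθ
    gcongr
    linarith
  calc P.real (largeRatioEvent W θ ε n)
      ≤ ∑ q ∈ gridPairs θ n, P.real {ω | 1 + ε ≤ |W (gridPt n q.2) ω - W (gridPt n q.1) ω| /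
          mu ((gridPt n q.2 : ℝ) - gridPt n q.1)} :=
        (measureReal_mono hsub (measure_ne_top _ _)).trans (measureReal_biUnion_finset_le _ _)
    _ ≤ (gridPairs θ n).card * B := by
        simpa using Finset.sum_le_sum hq
    _ ≤ 3 * Real.exp n * (2 * Real.exp (n * θ)) * B := by gcongr
    _ = _ := by
        rw [hB, mul_assoc 2, ← Real.exp_add, Real.mul_rpow two_pos.le (Real.exp_pos _).le,
          ← Real.exp_mul, show -((1 - θ) * (1 + ε) ^ 2 - (1 + θ)) * n
            = n + n * θ + (n * θ + -n) * (1 + ε) ^ 2 by ring, Real.exp_add, Real.exp_add]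
        ring

theorem exists_measureReal_lowerCount_le {θ η : ℝ} (p : ℝ) (hθ : θ < 1) (hη : 0 < η)
    (hηθ : η < θ) (hp : 0 ≤ p) :
    ∃ K : ℝ, 0 < K ∧ ∀ (Ω : Type u) (_ : MeasurableSpace Ω) (P : Measure Ω) (W : ℝ≥0 → Ω → ℝ),
      IsPreBrownianReal W P → ∀ k : ℕ, 1 ≤ k →
        P.real {ω | (k : ℕ∞) ≤ lowerCount (fun t ↦ W t ω) θ}
          ≤ K * Real.exp (-p * Real.exp (η * k)) := by
  obtain ⟨C, hC0, hC⟩ := exists_measureReal_smallIncrEvent_le.{u} p hθ hη hηθ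
  have hr : Real.exp (-1) < 1 := by rw [Real.exp_lt_one_iff]; norm_num
  have hr' : 0 < 1 - Real.exp (-1) := sub_pos.2 hr
  refine ⟨C / (1 - Real.exp (-1)), by positivity, fun Ω _ P W hW k hk ↦ ?_⟩
  have hprob : IsProbabilityMeasure P := hW.isGaussianProcess.isProbabilityMeasure
  have hle : ∀ n ≥ k, P.real (smallIncrEvent W θ n)
      ≤ C * Real.exp (-p * Real.exp (η * k)) * Real.exp (-1) ^ n := by
    intro n hn
    refine (hC Ω _ P W hW n).trans ?_
    rw [← Real.exp_nat_mul, mul_neg_one]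
    have : (k : ℝ) ≤ n := by exact_mod_cast hn
    gcongr C * ?_ * _
    rw [Real.exp_le_exp, neg_mul, neg_mul, neg_le_neg_iff]
    gcongr
  calc P.real {ω | (k : ℕ∞) ≤ lowerCount (fun t ↦ W t ω) θ}
      ≤ P.real {ω | ∃ n ≥ k, ω ∈ smallIncrEvent W θ n} := by
        refine measureReal_mono fun ω hω ↦ ?_
        obtain ⟨n, hn, hn1, hnle⟩ := exists_ge_of_le_encard (fun n hn ↦ hn.1) hk
          (show (k : ℕ∞) ≤ lowerCount (fun t ↦ W t ω) θ from hω)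
        exact ⟨n, hn, mem_smallIncrEvent_of_maxGridIncr_le hn1 hnle⟩
    _ ≤ C * Real.exp (-p * Real.exp (η * k)) / (1 - Real.exp (-1)) * Real.exp (-1) ^ k :=
        measureReal_exists_ge_le (Real.exp_pos _).le hr hle
    _ ≤ C * Real.exp (-p * Real.exp (η * k)) / (1 - Real.exp (-1)) * 1 := by
        gcongr
        exact pow_le_one₀ (Real.exp_pos _).le hr.le
    _ = _ := by ring

theorem measureReal_upperCount_le (hW : IsPreBrownianReal W P) {θ ε ρ : ℝ} (hθ : 0 ≤ θ)
    (hε : 0 ≤ ε) (hρ : ρ = (1 - θ) * (1 + ε) ^ 2 - (1 + θ)) (hρ0 : 0 < ρ) {k : ℕ} (hk : 1 ≤ k) :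
    P.real {ω | (k : ℕ∞) ≤ upperCount (fun t ↦ W t ω) θ ε}
      ≤ 12 * 2 ^ ((1 + ε) ^ 2) / (1 - Real.exp (-ρ)) * Real.exp (-ρ * k) := by
  have hprob : IsProbabilityMeasure P := hW.isGaussianProcess.isProbabilityMeasure
  have hpow : ∀ n : ℕ, Real.exp (-ρ) ^ n = Real.exp (-ρ * n) := fun n ↦ by
    rw [← Real.exp_nat_mul, mul_comm]
  rw [← hpow]
  refine (measureReal_mono fun ω hω ↦ ?_).trans (measureReal_exists_ge_le
    (A := largeRatioEvent W θ ε) (Real.exp_pos _).le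
    (Real.exp_lt_one_iff.2 (neg_neg_of_pos hρ0)) fun n _ ↦ ?_)
  · obtain ⟨n, hn, -, -, hnle⟩ := exists_ge_of_le_encard (fun n hn ↦ hn.1) hk
      (show (k : ℕ∞) ≤ upperCount (fun t ↦ W t ω) θ ε from hω)
    exact ⟨n, hn, hnle⟩
  · rw [hpow, hρ]
    exact measureReal_largeRatioEvent_le hW hθ hε n

/-! ### Hölder continuity by dyadic chaining -/

/-- The dyadic point `⌊2 ^ p * s⌋ / 2 ^ p`, the largest one of level `p` that is at most `s`. -/
noncomputable def dyadicFloor (p : ℕ) (s : ℝ≥0) : ℝ≥0 := ⌊2 ^ p * s⌋₊ / 2 ^ p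

lemma dyadicFloor_le (p : ℕ) (s : ℝ≥0) : dyadicFloor p s ≤ s := by
  rw [dyadicFloor, div_le_iff₀ (by positivity), mul_comm s]
  exact Nat.floor_le zero_le

lemma tendsto_dyadicFloor (s : ℝ≥0) : Tendsto (fun p ↦ dyadicFloor p s) atTop (𝓝 s) := by
  have hlow : ∀ p : ℕ, s - (1 / 2) ^ p ≤ dyadicFloor p s := by
    intro p
    rw [tsub_le_iff_right, dyadicFloor, one_div, inv_pow, ← one_div, ← add_div,
      le_div_iff₀ (by positivity), mul_comm s]
    exact (Nat.lt_floor_add_one _).le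
  have h0 : Tendsto (fun p : ℕ ↦ s - (1 / 2 : ℝ≥0) ^ p) atTop (𝓝 (s - 0)) :=
    tendsto_const_nhds.sub (NNReal.tendsto_pow_atTop_nhds_zero_of_lt_one
      (by rw [← NNReal.coe_lt_coe]; norm_num))
  rw [tsub_zero] at h0
  exact tendsto_of_tendsto_of_tendsto_of_le_of_le h0 tendsto_const_nhds hlow
    fun p ↦ dyadicFloor_le p s

lemma abs_sub_dyadicFloor_succ_le {w : ℝ≥0 → ℝ} {p : ℕ} {b : ℝ} (hb : 0 ≤ b)
    (hw : ∀ k < 2 ^ (p + 1), |w ((k + 1 : ℕ) / 2 ^ (p + 1)) - w (k / 2 ^ (p + 1))| ≤ b)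
    {s : ℝ≥0} (hs : s ≤ 1) : |w (dyadicFloor p s) - w (dyadicFloor (p + 1) s)| ≤ b := by
  set m := ⌊2 ^ p * s⌋₊ with hm
  have h1 : (m : ℝ≥0) ≤ 2 ^ p * s := Nat.floor_le zero_le
  have h2 : 2 ^ p * s < m + 1 := Nat.lt_floor_add_one _
  have h3 : 2 * m ≤ ⌊2 ^ (p + 1) * s⌋₊ := by
    refine Nat.le_floor ?_
    rw [pow_succ, mul_right_comm, mul_comm _ (2 : ℝ≥0)]
    push_cast
    gcongr
  have h4 : ⌊2 ^ (p + 1) * s⌋₊ < 2 * m + 2 := by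
    refine (Nat.floor_lt zero_le).2 ?_
    rw [pow_succ, mul_right_comm, mul_comm _ (2 : ℝ≥0)]
    push_cast
    rw [show (2 * m + 2 : ℝ≥0) = 2 * (m + 1) by ring]
    gcongr
  have h5 : ⌊2 ^ (p + 1) * s⌋₊ ≤ 2 ^ (p + 1) := by
    refine Nat.floor_le_of_le ?_
    push_cast
    exact mul_le_of_le_one_right zero_le hs
  have hd : dyadicFloor p s = ((2 * m : ℕ) : ℝ≥0) / 2 ^ (p + 1) := by
    rw [dyadicFloor, ← hm, pow_succ]
    push_cast
    rw [mul_comm (2 ^ p : ℝ≥0), mul_div_mul_left _ _ two_ne_zero]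
  rcases (by omega : ⌊2 ^ (p + 1) * s⌋₊ = 2 * m ∨ ⌊2 ^ (p + 1) * s⌋₊ = 2 * m + 1) with h | h
  · rw [hd, dyadicFloor, h, sub_self, abs_zero]
    exact hb
  · rw [hd, dyadicFloor, h, abs_sub_comm]
    exact hw (2 * m) (by omega)

/-- If from level `p₀` on the increments over dyadic intervals of level `p` are at most `r ^ p`,
then a continuous path has oscillation `O(r ^ n)` over intervals of length `2 ^ {-n}`: expand both
end points along their dyadic approximations. -/
lemma abs_sub_le_of_dyadic {w : ℝ≥0 → ℝ} (hc : Continuous w) {r : ℝ} (hr0 : 0 < r) (hr1 : r < 1)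
    {p₀ : ℕ} (hw : ∀ p ≥ p₀, ∀ k < 2 ^ p, |w ((k + 1 : ℕ) / 2 ^ p) - w (k / 2 ^ p)| ≤ r ^ p)
    {n : ℕ} (hn : p₀ ≤ n) {s t : ℝ≥0} (hst : s ≤ t) (ht : t ≤ 1)
    (hd : (t : ℝ) - s ≤ (1 / 2) ^ n) : |w s - w t| ≤ 3 / (1 - r) * r ^ n := by
  have hr' : 0 < 1 - r := sub_pos.2 hr1
  have happrox : ∀ u ≤ (1 : ℝ≥0), |w (dyadicFloor n u) - w u| ≤ r ^ n / (1 - r) := by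
    intro u hu
    have htend : Tendsto (fun i ↦ w (dyadicFloor (n + i) u)) atTop (𝓝 (w u)) :=
      (hc.tendsto u).comp ((tendsto_dyadicFloor u).comp
        (tendsto_atTop_mono (fun i ↦ Nat.le_add_left i n) tendsto_id))
    have hstep : ∀ i, dist (w (dyadicFloor (n + i) u)) (w (dyadicFloor (n + (i + 1)) u))
        ≤ r ^ n * r ^ i := by
      intro i
      rw [← pow_add, Real.dist_eq]
      refine (abs_sub_dyadicFloor_succ_le (by positivity) (hw (n + i + 1) (by omega)) hu).trans ?_
      exact pow_le_pow_of_le_one hr0.le hr1.le (by omega)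
    simpa [Real.dist_eq] using dist_le_of_le_geometric_of_tendsto₀ r (r ^ n) hr1 hstep htend
  have hmid : |w (dyadicFloor n s) - w (dyadicFloor n t)| ≤ r ^ n := by
    have h1 : ⌊2 ^ n * s⌋₊ ≤ ⌊2 ^ n * t⌋₊ := Nat.floor_mono (by gcongr)
    have h2 : ⌊2 ^ n * t⌋₊ < ⌊2 ^ n * s⌋₊ + 2 := by
      refine (Nat.floor_lt zero_le).2 ?_
      have h3 : 2 ^ n * s < ⌊2 ^ n * s⌋₊ + 1 := Nat.lt_floor_add_one _
      have h4 : 2 ^ n * t ≤ 2 ^ n * s + 1 := by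
        rw [← NNReal.coe_le_coe]
        push_cast
        have := mul_le_mul_of_nonneg_left hd (by positivity : (0 : ℝ) ≤ 2 ^ n)
        rw [← mul_pow, mul_one_div_cancel two_ne_zero, one_pow] at this
        linarith
      refine h4.trans_lt ?_
      push_cast
      rw [show (2 : ℝ≥0) = 1 + 1 by norm_num, ← add_assoc] at *
      gcongr
    have h5 : ⌊2 ^ n * t⌋₊ ≤ 2 ^ n := by
      refine Nat.floor_le_of_le ?_
      push_cast
      exact mul_le_of_le_one_right zero_le ht
    rcases (by omega : ⌊2 ^ n * t⌋₊ = ⌊2 ^ n * s⌋₊ ∨ ⌊2 ^ n * t⌋₊ = ⌊2 ^ n * s⌋₊ + 1) with h | h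
    · rw [dyadicFloor, dyadicFloor, h, sub_self, abs_zero]
      positivity
    · rw [dyadicFloor, dyadicFloor, h, abs_sub_comm]
      exact hw n hn _ (by omega)
  have hr : r ^ n ≤ r ^ n / (1 - r) := le_div_self (by positivity) hr' (by linarith)
  calc |w s - w t| ≤ |w (dyadicFloor n s) - w s| + |w (dyadicFloor n s) - w (dyadicFloor n t)|
        + |w (dyadicFloor n t) - w t| := by
        rw [abs_sub_comm (w (dyadicFloor n s)) (w s)]
        exact (abs_sub_le _ (w (dyadicFloor n t)) _).trans
          (add_le_add_left (abs_sub_le _ _ _) _)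
    _ ≤ r ^ n / (1 - r) + r ^ n / (1 - r) + r ^ n / (1 - r) := by
        gcongr
        exacts [happrox s (hst.trans ht), hmid.trans hr, happrox t ht]
    _ = _ := by ring

lemma exp_neg_le_div_pow (k : ℕ) {y : ℝ} (hy : 0 < y) :
    Real.exp (-y) ≤ k.factorial / y ^ k := by
  rw [Real.exp_neg, ← one_div, div_le_div_iff₀ (Real.exp_pos y) (by positivity), one_mul]
  have := Real.pow_div_factorial_le_exp y hy.le k
  rw [div_le_iff₀ (by positivity)] at this
  linarith

/-- Borel–Cantelli over the dyadic levels: at level `p` the threshold `2 ^ {-β p}` exceeds the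
standard deviation `2 ^ {-p / 2}` by a geometrically growing factor, so that even after summing over
the `2 ^ p` intervals the probabilities decay geometrically. -/
lemma ae_eventually_dyadic_increment_le (hW : IsPreBrownianReal W P) {β : ℝ} (hβ : β < 1 / 2) :
    ∀ᵐ ω ∂P, ∀ᶠ p : ℕ in atTop, ∀ k < 2 ^ p,
      |W ((k + 1 : ℕ) / 2 ^ p) ω - W (k / 2 ^ p) ω| ≤ ((1 / 2 : ℝ) ^ β) ^ p := by
  have hprob : IsProbabilityMeasure P := hW.isGaussianProcess.isProbabilityMeasure
  set r := (1 / 2 : ℝ) ^ β with hr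
  have hr0 : 0 < r := by positivity
  -- `a > 1` is the growth rate of the squared threshold over the variance.
  set a := 2 * r ^ 2 with ha
  have ha1 : 1 < a := by
    have : a = (2 : ℝ) ^ (1 - 2 * β) := by
      rw [ha, hr, one_div, Real.inv_rpow two_pos.le, ← Real.rpow_neg two_pos.le,
        ← Real.rpow_natCast, ← Real.rpow_mul two_pos.le, Real.rpow_sub two_pos, Real.rpow_one,
        div_eq_mul_inv, ← Real.rpow_neg two_pos.le]
      congr 2
      push_cast
      ring
    rw [this]
    exact Real.one_lt_rpow one_lt_two (by linarith)
  -- The tail `exp (-a ^ p / 2)` is bounded by a multiple of `(a ^ m) ^ {-p} ≤ 4 ^ {-p}`, which beats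
  -- the number `2 ^ p` of intervals.
  obtain ⟨m, hm⟩ := pow_unbounded_of_one_lt 4 ha1
  let A : ℕ → Set Ω := fun p ↦
    {ω | ∃ k < 2 ^ p, r ^ p ≤ |W ((k + 1 : ℕ) / 2 ^ p) ω - W (k / 2 ^ p) ω|}
  have hA : ∀ p, P.real (A p) ≤ 2 * (m.factorial * 2 ^ m) * (1 / 2) ^ p := by
    intro p
    have hsub : A p ⊆ ⋃ k ∈ Finset.range (2 ^ p),
        {ω | r ^ p ≤ |(W ((k + 1 : ℕ) / 2 ^ p) - W (k / 2 ^ p)) ω|} := by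
      rintro ω ⟨k, hk, hle⟩
      exact Set.mem_biUnion (Finset.mem_coe.2 (Finset.mem_range.2 hk)) hle
    have hone : ∀ k : ℕ, P.real {ω | r ^ p ≤ |(W ((k + 1 : ℕ) / 2 ^ p) - W (k / 2 ^ p)) ω|}
        ≤ 2 * (m.factorial * 2 ^ m * (1 / 4) ^ p) := by
      intro k
      have hlaw := hW.hasLaw_sub ((k + 1 : ℕ) / 2 ^ p) (k / 2 ^ p)
      have hn : ((nndist (((k + 1 : ℕ) / 2 ^ p : ℝ≥0)).1 ((k / 2 ^ p : ℝ≥0)).1 : ℝ≥0) : ℝ)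
          = (1 / 2) ^ p := by
        rw [coe_nndist, Real.dist_eq]
        change |(((k + 1 : ℕ) / 2 ^ p : ℝ≥0) : ℝ) - ((k / 2 ^ p : ℝ≥0) : ℝ)| = _
        push_cast
        rw [← sub_div, add_sub_cancel_left, abs_of_pos (by positivity), one_div_pow]
      refine (measureReal_le_abs_of_hasLaw_gaussianReal hlaw (by positivity)).trans ?_
      rw [hn]
      gcongr
      calc Real.exp (-(r ^ p) ^ 2 / (2 * (1 / 2) ^ p)) = Real.exp (-(a ^ p / 2)) := by
            congr 1
            rw [ha, mul_pow, one_div_pow, pow_right_comm]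
            field_simp
        _ ≤ m.factorial / (a ^ p / 2) ^ m := exp_neg_le_div_pow m (by positivity)
        _ = m.factorial * 2 ^ m * (1 / a ^ m) ^ p := by
            rw [div_pow, one_div_pow, pow_right_comm]
            field_simp
        _ ≤ _ := by gcongr
    calc P.real (A p) ≤ ∑ k ∈ Finset.range (2 ^ p),
          P.real {ω | r ^ p ≤ |(W ((k + 1 : ℕ) / 2 ^ p) - W (k / 2 ^ p)) ω|} :=
          (measureReal_mono hsub (measure_ne_top _ _)).trans (measureReal_biUnion_finset_le _ _)
      _ ≤ ∑ k ∈ Finset.range (2 ^ p), 2 * (m.factorial * 2 ^ m * (1 / 4 : ℝ) ^ p) :=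
          Finset.sum_le_sum fun k _ ↦ hone k
      _ = _ := by
          rw [Finset.sum_const, Finset.card_range, nsmul_eq_mul]
          push_cast
          rw [show (1 / 4 : ℝ) = 1 / 2 * (1 / 2) by norm_num, mul_pow]
          have : (2 : ℝ) ^ p * (1 / 2) ^ p = 1 := by rw [← mul_pow]; norm_num
          linear_combination 2 * (m.factorial * 2 ^ m) * (1 / 2) ^ p * this
  filter_upwards [ae_eventually_notMem_of_summable
    ((summable_geometric_of_lt_one (by norm_num) (by norm_num)).mul_left _) hA] with ω hω
  filter_upwards [hω] with p hp k hk
  by_contra! hlt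
  exact hp ⟨k, hk, hlt.le⟩

/-- Brownian paths are almost surely `β`-Hölder on `[0, 1]` at small scales, for `β < 1 / 2`. -/
lemma ae_exists_abs_sub_le_rpow (hW : IsBrownianReal W P) {β : ℝ} (hβ0 : 0 < β)
    (hβ : β < 1 / 2) :
    ∀ᵐ ω ∂P, ∃ C h₀ : ℝ, 0 ≤ C ∧ 0 < h₀ ∧ ∀ h, 0 < h → h ≤ h₀ → ∀ s t : ℝ≥0, s ≤ t → t ≤ 1 →
      (t : ℝ) - s ≤ h → |W s ω - W t ω| ≤ C * h ^ β := by
  set r := (1 / 2 : ℝ) ^ β with hr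
  have hr0 : 0 < r := by positivity
  have hr1 : r < 1 := Real.rpow_lt_one (by norm_num) (by norm_num) hβ0
  have hr' : 0 < 1 - r := sub_pos.2 hr1
  filter_upwards [hW.cont, ae_eventually_dyadic_increment_le hW.toIsPreBrownianReal hβ]
    with ω hcont hω
  obtain ⟨p₀, hp₀⟩ := eventually_atTop.1 hω
  refine ⟨3 / (1 - r) * 2 ^ β, (1 / 2) ^ p₀, by positivity, by positivity,
    fun h hh0 hh s t hst ht hd ↦ ?_⟩
  obtain ⟨n, hn1, hn2⟩ := exists_nat_pow_near_of_lt_one hh0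
    (hh.trans (pow_le_one₀ (by norm_num) (by norm_num))) (by norm_num : (0 : ℝ) < 1 / 2)
    (by norm_num)
  have hn : p₀ ≤ n := by
    have := (pow_lt_pow_iff_right_of_lt_one₀ (by norm_num : (0 : ℝ) < 1 / 2) (by norm_num)).1
      (hn1.trans_le hh)
    omega
  refine (abs_sub_le_of_dyadic hcont hr0 hr1 hp₀ hn hst ht (hd.trans hn2)).trans ?_
  rw [mul_assoc, ← Real.mul_rpow two_pos.le hh0.le, hr, ← Real.rpow_natCast,
    ← Real.rpow_mul (by norm_num), mul_comm β, Real.rpow_mul (by norm_num), Real.rpow_natCast]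
  gcongr
  rw [pow_succ] at hn1
  linarith

/-! ### From the grid to all pairs of times -/

lemma mu_pos {δ : ℝ} (h0 : 0 < δ) (h1 : δ < 1) : 0 < mu δ := by
  have : 0 < Real.log (1 / δ) := Real.log_pos (by rwa [lt_div_iff₀ h0, one_mul])
  exact Real.sqrt_pos.2 (by positivity)

lemma sqrt_le_mu {δ : ℝ} (h0 : 0 < δ) (h1 : 1 ≤ Real.log (1 / δ)) : √δ ≤ mu δ :=
  Real.sqrt_le_sqrt (by nlinarith)

/-- `mu` is monotone on `(0, e⁻¹]`, where `δ * log (1 / δ)` increases. -/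
lemma mu_le_mu {d δ : ℝ} (hd : 0 < d) (hdδ : d ≤ δ) (h1 : 1 ≤ Real.log (1 / δ)) :
    mu d ≤ mu δ := by
  have hδ : 0 < δ := hd.trans_le hdδ
  refine Real.sqrt_le_sqrt ?_
  have hlog : Real.log (1 / d) = Real.log (1 / δ) + Real.log (δ / d) := by
    rw [← Real.log_mul (by positivity) (by positivity)]
    congr 1
    field_simp
  have hle : d * Real.log (δ / d) ≤ δ - d := by
    have := mul_le_mul_of_nonneg_left (Real.log_le_sub_one_of_pos (div_pos hδ hd)) hd.le
    rwa [mul_sub, mul_div_cancel₀ _ hd.ne', mul_one] at this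
  rw [hlog]
  nlinarith [mul_nonneg (sub_nonneg.2 hdδ) (sub_nonneg.2 h1)]

lemma ae_eventually_notMem_smallIncrEvent (hW : IsPreBrownianReal W P) {θ : ℝ} (hθ0 : 0 < θ)
    (hθ : θ < 1) : ∀ᵐ ω ∂P, ∀ᶠ n in atTop, ω ∉ smallIncrEvent W θ n := by
  have hprob : IsProbabilityMeasure P := hW.isGaussianProcess.isProbabilityMeasure
  obtain ⟨C, -, hC⟩ := exists_measureReal_smallIncrEvent_le 0 hθ (half_pos hθ0) (half_lt_self hθ0)
  refine ae_eventually_notMem_of_summable (Real.summable_exp_neg_nat.mul_left C) fun n ↦ ?_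
  simpa using hC _ _ P W hW n

lemma ae_eventually_maxGridRatio_lt (hW : IsPreBrownianReal W P) {θ ε : ℝ} (hθ : 0 ≤ θ)
    (hε : 0 ≤ ε) (hρ : 0 < (1 - θ) * (1 + ε) ^ 2 - (1 + θ)) :
    ∀ᵐ ω ∂P, ∀ᶠ n in atTop, maxGridRatio (fun t ↦ W t ω) θ n < 1 + ε := by
  have hprob : IsProbabilityMeasure P := hW.isGaussianProcess.isProbabilityMeasure
  have hsum : Summable fun n : ℕ ↦
      12 * 2 ^ ((1 + ε) ^ 2) * Real.exp (-((1 - θ) * (1 + ε) ^ 2 - (1 + θ)) * n) := by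
    refine Summable.mul_left _ ?_
    simpa only [mul_comm] using Real.summable_exp_nat_mul_iff.2 (neg_neg_of_pos hρ)
  filter_upwards [ae_eventually_notMem_of_summable hsum
    fun n ↦ measureReal_largeRatioEvent_le hW hθ hε n] with ω hω
  filter_upwards [hω] with n hn
  exact not_le.1 hn

lemma coe_le_maxRatio_of_notMem_smallIncrEvent {θ : ℝ} {n : ℕ} (hn : 1 ≤ n) {ω : Ω}
    (h : ω ∉ smallIncrEvent W θ n) :
    ((√(1 - θ) : ℝ) : EReal) ≤ maxRatio (fun t ↦ W t ω) (Real.exp (-(n : ℝ))) := by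
  simp only [smallIncrEvent, Set.mem_ofPred_eq, not_forall, not_le] at h
  obtain ⟨j, hj, hlt⟩ := h
  have hmu : 0 < mu (Real.exp (-(n : ℝ))) :=
    mu_pos (Real.exp_pos _) (Real.exp_lt_one_iff.2 (by simpa using by omega))
  have hle1 : gridPt n (j + 1) ≤ 1 := by
    rw [← NNReal.coe_le_coe, coe_gridPt, NNReal.coe_one, div_le_one (Real.exp_pos _)]
    exact (Nat.lt_ceil.1 (by omega)).le
  have hd : (gridPt n (j + 1) : ℝ) - gridPt n j ≤ Real.exp (-(n : ℝ)) := by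
    rw [gridPt_sub_gridPt]
    push_cast
    rw [add_sub_cancel_left, one_mul]
  refine le_trans ?_ (le_iSup₂_of_le (gridPt n j) (gridPt n (j + 1)) <|
    le_iSup₂_of_le (gridPt_lt_gridPt j.lt_succ_self) hle1 <| le_iSup_of_le hd le_rfl)
  rw [EReal.coe_le_coe_iff, le_div_iff₀ hmu, abs_sub_comm]
  exact hlt.le

lemma ae_sqrt_le_limsup_maxRatio (hW : IsPreBrownianReal W P) {θ : ℝ} (hθ0 : 0 < θ) (hθ : θ < 1) :
    ∀ᵐ ω ∂P, ((√(1 - θ) : ℝ) : EReal)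
      ≤ limsup (fun δ : ℝ ↦ maxRatio (fun t ↦ W t ω) δ) (𝓝[>] (0 : ℝ)) := by
  filter_upwards [ae_eventually_notMem_smallIncrEvent hW hθ0 hθ] with ω hω
  have htend : Tendsto (fun n : ℕ ↦ Real.exp (-(n : ℝ))) atTop (𝓝[>] 0) :=
    tendsto_nhdsWithin_iff.2 ⟨Real.tendsto_exp_neg_atTop_nhds_zero.comp
      tendsto_natCast_atTop_atTop, Eventually.of_forall fun n ↦ Real.exp_pos _⟩
  refine le_limsup_of_frequently_le' (htend.frequently (Eventually.frequently ?_))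
  filter_upwards [hω, eventually_ge_atTop 1] with n hn h1
  exact coe_le_maxRatio_of_notMem_smallIncrEvent h1 hn

lemma abs_sub_gridPt_le {w : ℝ≥0 → ℝ} {θ ε : ℝ} {n : ℕ} (hε : 0 ≤ ε)
    (hw : maxGridRatio w θ n < 1 + ε) {i j : ℕ} (hij : i < j) (hj : (j : ℝ) ≤ Real.exp n)
    {δ : ℝ} (hδn : δ * Real.exp n ≤ Real.exp (n * θ))
    (hδ1 : 1 ≤ Real.log (1 / δ)) (hd : ((j : ℝ) - i) * Real.exp (-(n : ℝ)) ≤ δ) :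
    |w (gridPt n j) - w (gridPt n i)| ≤ (1 + ε) * mu δ := by
  have hijr : (0 : ℝ) < (j : ℝ) - i := sub_pos.2 (by exact_mod_cast hij)
  have hd0 : 0 < ((j : ℝ) - i) * Real.exp (-(n : ℝ)) := by positivity
  have hδ0 : 0 < δ := hd0.trans_le hd
  have hδlt : δ < 1 := by
    by_contra! hcon
    have := Real.log_nonpos (by positivity) ((div_le_one hδ0).2 hcon)
    linarith
  have hmem : (i, j) ∈ gridPairs θ n := by
    have hjc : j ≤ ⌈Real.exp n⌉₊ := by exact_mod_cast hj.trans (Nat.le_ceil _)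
    have hjic : j - i ≤ ⌈Real.exp (n * θ)⌉₊ := by
      rw [← Nat.cast_le (α := ℝ), Nat.cast_sub hij.le]
      refine le_trans ?_ ((hδn).trans (Nat.le_ceil _))
      rwa [Real.exp_neg, ← div_eq_mul_inv, div_le_iff₀ (Real.exp_pos _)] at hd
    simp only [gridPairs, Finset.mem_filter, Finset.mem_product, Finset.mem_range]
    omega
  have hlt := ((Finset.sup'_lt_iff _).1 hw) (i, j) hmem
  rw [div_lt_iff₀ (mu_pos hd0 (hd.trans_lt hδlt))] at hlt
  refine hlt.le.trans ?_
  gcongr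
  exact mu_le_mu hd0 hd hδ1

/-- The deterministic half of the upper bound: round `s` up and `t` down to the grid of mesh
`e ^ {-n}`. The grid increment is controlled by `maxGridRatio`, the two rounding errors by the
Hölder bound. -/
lemma abs_sub_le_of_grid {w : ℝ≥0 → ℝ} {θ ε : ℝ} {n : ℕ} (hε : 0 ≤ ε)
    (hw : maxGridRatio w θ n < 1 + ε) {b : ℝ}
    (hb : ∀ s t : ℝ≥0, s ≤ t → t ≤ 1 → (t : ℝ) - s ≤ 2 * Real.exp (-(n : ℝ)) → |w s - w t| ≤ b)
    {δ : ℝ} (hδn : δ * Real.exp n ≤ Real.exp (n * θ)) (hδ1 : 1 ≤ Real.log (1 / δ))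
    {s t : ℝ≥0} (hst : s < t) (ht : t ≤ 1) (hd : (t : ℝ) - s ≤ δ) :
    |w s - w t| ≤ (1 + ε) * mu δ + 2 * b := by
  have hE : 0 < Real.exp n := Real.exp_pos n
  have hE' : Real.exp (-(n : ℝ)) = 1 / Real.exp n := by rw [Real.exp_neg, one_div]
  have hmu : 0 ≤ mu δ := Real.sqrt_nonneg _
  have hb0 : 0 ≤ b := by simpa using hb 0 0 le_rfl zero_le_one (by simp; positivity)
  set i := ⌈s * Real.exp n⌉₊ with hi
  set j := ⌊t * Real.exp n⌋₊ with hj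
  have hi1 : s * Real.exp n ≤ i := Nat.le_ceil _
  have hi2 : i < s * Real.exp n + 1 := Nat.ceil_lt_add_one (by positivity)
  have hj1 : j ≤ t * Real.exp n := Nat.floor_le (by positivity)
  have hj2 : t * Real.exp n < j + 1 := Nat.lt_floor_add_one _
  rcases lt_or_ge i j with hij | hij
  · have hjE : (j : ℝ) ≤ Real.exp n :=
      hj1.trans (mul_le_of_le_one_left hE.le (by exact_mod_cast ht))
    have hjt : gridPt n j ≤ t := by
      rw [← NNReal.coe_le_coe, coe_gridPt, div_le_iff₀ hE]
      exact hj1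
    have hsi : s ≤ gridPt n i := by
      rw [← NNReal.coe_le_coe, coe_gridPt, le_div_iff₀ hE]
      exact hi1
    have h1 : |w s - w (gridPt n i)| ≤ b := by
      refine hb _ _ hsi (((gridPt_lt_gridPt hij).le.trans hjt).trans ht) ?_
      rw [coe_gridPt, hE', sub_le_iff_le_add, div_le_iff₀ hE, add_mul, mul_assoc,
        one_div_mul_cancel hE.ne']
      linarith
    have h2 : |w (gridPt n j) - w t| ≤ b := by
      refine hb _ _ hjt ht ?_
      rw [coe_gridPt, hE', sub_le_iff_le_add', ← mul_le_mul_iff_left₀ hE, add_mul, mul_assoc,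
        one_div_mul_cancel hE.ne', div_mul_cancel₀ _ hE.ne']
      linarith
    have h3 : |w (gridPt n j) - w (gridPt n i)| ≤ (1 + ε) * mu δ := by
      refine abs_sub_gridPt_le hε hw hij hjE hδn hδ1 (le_trans ?_ hd)
      rw [hE', mul_one_div, div_le_iff₀ hE]
      linarith
    rw [abs_sub_comm] at h3
    have h4 := abs_sub_le (w s) (w (gridPt n i)) (w t)
    have h5 := abs_sub_le (w (gridPt n i)) (w (gridPt n j)) (w t)
    linarith
  -- Without a grid interval between `s` and `t`, their distance is at most twice the mesh.
  · have hle : |w s - w t| ≤ b := by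
      refine hb s t hst.le ht ?_
      rw [hE', mul_one_div, le_div_iff₀ hE]
      have : (j : ℝ) ≤ i := by exact_mod_cast hij
      linarith
    have : 0 ≤ (1 + ε) * mu δ := by positivity
    linarith

/-! ### The almost sure limsup -/

/-- A path that satisfies the grid bound at all fine levels and is `β`-Hölder with
`β > (1 - θ) / 2` obeys Lévy's modulus up to a factor `1 + 2 * ε`. -/
lemma eventually_maxRatio_le {w : ℝ≥0 → ℝ} {θ ε β C h₀ : ℝ} (hθ : θ < 1)
    (hε : 0 < ε) (hβ : 0 ≤ β) (hβθ : (1 - θ) / 2 < β) (hC : 0 ≤ C) (hh₀ : 0 < h₀)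
    (hgrid : ∀ᶠ n in atTop, maxGridRatio w θ n < 1 + ε)
    (hhol : ∀ h, 0 < h → h ≤ h₀ → ∀ s t : ℝ≥0, s ≤ t → t ≤ 1 →
      (t : ℝ) - s ≤ h → |w s - w t| ≤ C * h ^ β) :
    ∀ᶠ δ in 𝓝[>] (0 : ℝ), maxRatio w δ ≤ ((1 + 2 * ε : ℝ) : EReal) := by
  have hθ' : 0 < 1 - θ := sub_pos.2 hθ
  have hγ : 0 < β / (1 - θ) - 1 / 2 := by
    rw [sub_pos, lt_div_iff₀ hθ']
    linarith
  -- The level `n` is the largest one for which the grid pairs still cover the distance `δ`.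
  have hL : Tendsto (fun δ : ℝ ↦ Real.log (1 / δ)) (𝓝[>] 0) atTop := by
    simpa only [one_div] using! Real.tendsto_log_atTop.comp tendsto_inv_nhdsGT_zero
  have hN : Tendsto (fun δ : ℝ ↦ ⌊Real.log (1 / δ) / (1 - θ)⌋₊) (𝓝[>] 0) atTop :=
    tendsto_nat_floor_atTop.comp (hL.atTop_div_const hθ')
  have hexp : Tendsto (fun n : ℕ ↦ 2 * Real.exp (-(n : ℝ))) atTop (𝓝 0) := by
    simpa using! (Real.tendsto_exp_neg_atTop_nhds_zero.comp tendsto_natCast_atTop_atTop).const_mul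
      (2 : ℝ)
  have herr : Tendsto (fun δ : ℝ ↦ 2 * (C * (2 ^ β * Real.exp β)) *
      Real.exp (-((β / (1 - θ) - 1 / 2) * Real.log (1 / δ)))) (𝓝[>] 0) (𝓝 0) := by
    simpa using! (Real.tendsto_exp_neg_atTop_nhds_zero.comp
      (hL.const_mul_atTop hγ)).const_mul (2 * (C * (2 ^ β * Real.exp β)))
  filter_upwards [self_mem_nhdsWithin, hL.eventually_ge_atTop 1, hN.eventually hgrid,
    hN.eventually (hexp.eventually_le_const hh₀), herr.eventually_le_const hε]
    with δ hδ0 hδ1 hw hnh₀ hsmall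
  replace hδ0 : 0 < δ := hδ0
  set L := Real.log (1 / δ) with hLdef
  set n := ⌊L / (1 - θ)⌋₊ with hn
  have hδexp : Real.exp (-L) = δ := by
    rw [hLdef, one_div, Real.log_inv, neg_neg, Real.exp_log hδ0]
  have hn1 : n * (1 - θ) ≤ L := (le_div_iff₀ hθ').1 (Nat.floor_le (by positivity))
  have hn2 : L / (1 - θ) < n + 1 := Nat.lt_floor_add_one _
  have hδn : δ * Real.exp n ≤ Real.exp (n * θ) := by
    rw [← hδexp, ← Real.exp_add, Real.exp_le_exp]
    linarith
  have hb0 := hhol (2 * Real.exp (-(n : ℝ))) (by positivity) hnh₀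
  have hbound : 2 * (C * (2 * Real.exp (-(n : ℝ))) ^ β) ≤ ε * mu δ := by
    have h1 : (2 * Real.exp (-(n : ℝ))) ^ β ≤
        2 ^ β * Real.exp β * Real.exp (-((β / (1 - θ) - 1 / 2) * L)) * √δ := by
      rw [Real.mul_rpow two_pos.le (Real.exp_pos _).le, ← Real.exp_mul, mul_assoc, mul_assoc,
        ← hδexp, ← Real.exp_half, ← Real.exp_add, ← Real.exp_add]
      gcongr
      have := mul_le_mul_of_nonneg_left hn2.le hβ
      rw [mul_div_left_comm] at this
      linarith
    calc 2 * (C * (2 * Real.exp (-(n : ℝ))) ^ β)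
        ≤ 2 * (C * (2 ^ β * Real.exp β * Real.exp (-((β / (1 - θ) - 1 / 2) * L)) * √δ)) := by
          gcongr
      _ = 2 * (C * (2 ^ β * Real.exp β)) * Real.exp (-((β / (1 - θ) - 1 / 2) * L)) * √δ := by
          ring
      _ ≤ ε * mu δ := by
          gcongr
          exact sqrt_le_mu hδ0 hδ1
  have hmu : 0 < mu δ := (Real.sqrt_pos.2 hδ0).trans_le (sqrt_le_mu hδ0 hδ1)
  refine iSup₂_le fun s t ↦ iSup₂_le fun hst ht ↦ iSup_le fun hd ↦ ?_
  rw [EReal.coe_le_coe_iff, div_le_iff₀ hmu]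
  have := abs_sub_le_of_grid hε.le hw hb0 hδn hδ1 hst ht hd
  linarith

lemma ae_limsup_maxRatio_le (hW : IsBrownianReal W P) {ε : ℝ} (hε0 : 0 < ε) (hε1 : ε ≤ 1) :
    ∀ᵐ ω ∂P, limsup (fun δ : ℝ ↦ maxRatio (fun t ↦ W t ω) δ) (𝓝[>] (0 : ℝ))
      ≤ ((1 + 2 * ε : ℝ) : EReal) := by
  -- With `θ = ε / 4` the exponent of the grid estimate is positive, and the Hölder exponent
  -- `1 / 2 - θ / 4` exceeds `(1 - θ) / 2`.
  have hρ : 0 < (1 - ε / 4) * (1 + ε) ^ 2 - (1 + ε / 4) := by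
    have : 0 ≤ ε * (1 - ε) := mul_nonneg hε0.le (by linarith)
    nlinarith [mul_nonneg hε0.le this]
  filter_upwards [ae_eventually_maxGridRatio_lt hW.toIsPreBrownianReal (by positivity) hε0.le hρ,
    ae_exists_abs_sub_le_rpow hW (β := 1 / 2 - ε / 4 / 4) (by linarith) (by linarith)]
    with ω hgrid hhol
  obtain ⟨C, h₀, hC, hh₀, hhol⟩ := hhol
  exact limsup_le_of_le (h := eventually_maxRatio_le (by linarith) hε0 (by linarith)
    (by linarith) hC hh₀ hgrid hhol)

theorem ae_limsup_maxRatio_eq_one (hW : IsBrownianReal W P) :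
    ∀ᵐ ω ∂P, limsup (fun δ : ℝ ↦ maxRatio (fun t ↦ W t ω) δ) (𝓝[>] (0 : ℝ)) = 1 := by
  have hlow : ∀ m : ℕ, ∀ᵐ ω ∂P, ((√(1 - 1 / ((m : ℝ) + 2)) : ℝ) : EReal)
      ≤ limsup (fun δ : ℝ ↦ maxRatio (fun t ↦ W t ω) δ) (𝓝[>] (0 : ℝ)) := fun m ↦
    ae_sqrt_le_limsup_maxRatio hW.toIsPreBrownianReal (by positivity)
      ((div_lt_one (by positivity)).2 (by linarith [(Nat.cast_nonneg m : (0 : ℝ) ≤ m)]))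
  have hupp : ∀ m : ℕ, ∀ᵐ ω ∂P,
      limsup (fun δ : ℝ ↦ maxRatio (fun t ↦ W t ω) δ) (𝓝[>] (0 : ℝ))
        ≤ ((1 + 2 * (1 / ((m : ℝ) + 1)) : ℝ) : EReal) := fun m ↦
    ae_limsup_maxRatio_le hW (by positivity)
      ((div_le_one (by positivity)).2 (by linarith [(Nat.cast_nonneg m : (0 : ℝ) ≤ m)]))
  have hlim : Tendsto (fun m : ℕ ↦ 1 / ((m : ℝ) + 1)) atTop (𝓝 0) :=
    tendsto_one_div_add_atTop_nhds_zero_nat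
  filter_upwards [ae_all_iff.2 hlow, ae_all_iff.2 hupp] with ω h1 h2
  have hupp_lim : Tendsto (fun m : ℕ ↦ ((1 + 2 * (1 / ((m : ℝ) + 1)) : ℝ) : EReal)) atTop
      (𝓝 1) := by
    rw [← EReal.coe_one]
    refine (continuous_coe_real_ereal.tendsto 1).comp ?_
    simpa using (hlim.const_mul 2).const_add 1
  have hlow_lim : Tendsto (fun m : ℕ ↦ ((√(1 - 1 / ((m : ℝ) + 2)) : ℝ) : EReal)) atTop
      (𝓝 1) := by
    rw [← EReal.coe_one]
    refine (continuous_coe_real_ereal.tendsto 1).comp ?_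
    have h := ((hlim.comp (tendsto_add_atTop_nat 1)).const_sub 1).sqrt
    rw [sub_zero, Real.sqrt_one] at h
    refine h.congr fun m ↦ ?_
    simp only [Function.comp_apply]
    push_cast
    rw [add_assoc, one_add_one_eq_two]
  exact le_antisymm (ge_of_tendsto' hupp_lim h2) (le_of_tendsto' hlow_lim h1)

end LevyModulus

theorem theorem2 :
    (∀ (Ω : Type u) (mΩ : MeasurableSpace Ω) (P : Measure Ω) (W : ℝ≥0 → Ω → ℝ),
      IsBrownianReal W P →
        ∀ᵐ ω ∂P, limsup (fun δ : ℝ => LevyModulus.maxRatio (fun t => W t ω) δ) (𝓝[>] (0 : ℝ)) = 1)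
    ∧
    (∀ θ η p : ℝ, 0 < θ → θ < 1 → 0 < η → η < θ → 0 ≤ p →
      p < 1 / (Real.exp η * Real.sqrt (4 * Real.pi * (1 - θ))) →
      ∃ K₁ : ℝ, 0 < K₁ ∧
        ∀ (Ω : Type u) (mΩ : MeasurableSpace Ω) (P : Measure Ω) (W : ℝ≥0 → Ω → ℝ),
          IsBrownianReal W P → ∀ k : ℕ, 1 ≤ k →
            P.real {ω | (k : ℕ∞) ≤ LevyModulus.lowerCount (fun t => W t ω) θ}
              ≤ K₁ * Real.exp (-p * Real.exp (η * k)))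
    ∧
    (∀ θ ε ρ : ℝ, 0 < θ → θ < 1 → (1 + θ) / (1 - θ) - 1 < ε →
      ρ = (1 - θ) * (1 + ε) ^ 2 - (1 + θ) →
      ∃ K : ℝ, 0 < K ∧
        ∀ (Ω : Type u) (mΩ : MeasurableSpace Ω) (P : Measure Ω) (W : ℝ≥0 → Ω → ℝ),
          IsBrownianReal W P → ∀ k : ℕ, 1 ≤ k →
            P.real {ω | (k : ℕ∞) ≤ LevyModulus.upperCount (fun t => W t ω) θ ε}
              ≤ 2 * Real.exp (9 / 8) *
                  ((k : ℝ) * (K / (1 - Real.exp (-ρ)) *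
                      Real.exp (-ρ * ((⌈1 / (1 - θ)⌉₊ : ℝ) - 1)) + 1) + 1) *
                  Real.exp (-ρ * k)) := by
  refine ⟨fun Ω _ P W hW ↦ LevyModulus.ae_limsup_maxRatio_eq_one hW, ?_, ?_⟩
  · intro θ η p _ hθ hη hηθ hp _
    obtain ⟨K, hK0, hK⟩ := LevyModulus.exists_measureReal_lowerCount_le.{u} p hθ hη hηθ hp
    exact ⟨K, hK0, fun Ω mΩ P W hW k hk ↦ hK Ω mΩ P W hW.toIsPreBrownianReal k hk⟩
  · intro θ ε ρ hθ0 hθ hε hρ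
    have hθ' : 0 < 1 - θ := sub_pos.2 hθ
    have hε' : 1 + θ < (1 + ε) * (1 - θ) := by
      rw [← div_lt_iff₀ hθ']
      linarith
    have hε0 : 0 ≤ ε := by
      by_contra! hneg
      nlinarith
    have hρ0 : 0 < ρ := by
      rw [hρ, sub_pos]
      nlinarith [mul_nonneg hε0 (hθ0.le.trans (by linarith : θ ≤ (1 + ε) * (1 - θ)))]
    have hr : 0 < 1 - Real.exp (-ρ) := sub_pos.2 (Real.exp_lt_one_iff.2 (neg_neg_of_pos hρ0))
    -- `K` is the constant of the union bound, rescaled to absorb the factor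
    -- `exp (-ρ * (⌈1 / (1 - θ)⌉₊ - 1))`.
    set A := 12 * (2 : ℝ) ^ ((1 + ε) ^ 2) with hA
    set E := -ρ * ((⌈1 / (1 - θ)⌉₊ : ℝ) - 1) with hE
    refine ⟨A * Real.exp (-E), by positivity, fun Ω mΩ P W hW k hk ↦ ?_⟩
    refine (LevyModulus.measureReal_upperCount_le hW.toIsPreBrownianReal hθ0.le hε0 hρ hρ0
      hk).trans ?_
    have hk1 : (1 : ℝ) ≤ k := by exact_mod_cast hk
    have hcancel : A * Real.exp (-E) / (1 - Real.exp (-ρ)) * Real.exp E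
        = A / (1 - Real.exp (-ρ)) := by
      rw [Real.exp_neg]
      field_simp
    rw [hcancel]
    set D := A / (1 - Real.exp (-ρ)) with hD
    have hD0 : 0 ≤ D := by positivity
    gcongr
    have h1 : D ≤ k * (D + 1) + 1 := by nlinarith
    have h2 : (1 : ℝ) ≤ 2 * Real.exp (9 / 8) := by
      linarith [Real.one_le_exp (by norm_num : (0 : ℝ) ≤ 9 / 8)]
    exact h1.trans (le_mul_of_one_le_left (hD0.trans h1) h2)
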